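/- Consider a $K$-armed stochastic bandit with reward laws $\nu_1,\dots,\nu_K$ of finite means $\mu_i$. In each round $t\ge 1$ a policy chooses an arm $A_t\in[K]$ and observes a feedback $Y_t\in\mathbb R$. Let $\mathcal F_{t}$ be a filtration that contains the observations of the first $t$ rounds and any extra randomness of the policy, such that $A_t$ is $\mathcal F_{t-1}$-measurable. Write $T_i(t)=\sum_{s=1}^t \mathbf 1\{A_s=i\}$. The feedback follows the bias model with initial biases $T_i^0\ge 1$ and reweighting functions $f_i$ (bounded, non-decreasing and Lipschitz on $(0,1]$) if, for all $t\ge1$, $$\mathbb E[Y_t\mid\mathcal F_{t-1}]=\mu_{A_t}\, f_{A_t}\!\left(\frac{T^0_{A_t}+T_{A_t}(t-1)}{\sum_{j}T^0_j+t-1}\right)$$ and $Y_t-\mathbb E[Y_t\mid\mathcal F_{t-1}]$ is conditionally $1$-subgaussian given $\mathcal F_{t-1}$. The regret is measured with unobserved true rewards $X_{i,t}\sim\nu_i$ that are independent of $\mathcal F_{t-1}$: $$R(n)=\max_{i^*\in[K]}\mathbb E\Big[\sum_{t=1}^n (X_{i^*,t}-X_{A_t,t})\Big].$$ The UCB policy,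 which ignores the bias, plays $A_t=t$ for $t\in[K]$, and for $t>K$ it plays an arm $$A_t\in\arg\max_{i\in[K]}\left(\widehat\mu_{i,t-1}+\sqrt{\frac{2\log t}{T_i(t-1)}}\right),\qquad \widehat\mu_{i,t-1}=\frac{\sum_{s=1}^{t-1}Y_s\mathbf 1\{A_s=i\}}{T_i(t-1)},$$ with ties broken in any way. Theorem. Let $K=2$, let $\nu_1,\nu_2$ be Bernoulli with means $\mu_1=0.9$ and $\mu_2=0.8$, let $T^0_1=10$ and $T^0_2=16216^{1.5}$, let $f_1(x)=f_2(x)=x$, and let the feedback be Bernoulli, $Y_t\in\{0,1\}$. This is an admissible instance of the bias model, UCB can be run in it, and for every run of UCB in it $$R(n)\ \ge\ 0.098\, n\qquad\text{for all } n\ge 16207 .$$ -/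

import Mathlib

open MeasureTheory ProbabilityTheory Set

noncomputable section

namespace AffinityBandit

/-- A stochastic `K`-armed bandit together with the data of a multiplicative affinity bias:
the reward laws of the arms, the reweighting functions and the initial biases. -/
structure BiasedBandit (K : ℕ) where
  /-- law of the true reward of each arm -/
  ν : Fin K → Measure ℝ
  /-- reweighting function of each arm, applied to the fraction of its pulls -/
  f : Fin K → ℝ → ℝ
  /-- initial bias of each arm -/
  T0 : Fin K → ℝ

namespace BiasedBandit

variable {K : ℕ} (E : BiasedBandit K)

/-- The unbiased mean of an arm. -/
def mean (i : Fin K) : ℝ := ∫ x, x ∂(E.ν i)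

/-- The standing requirements: the arms have laws of finite mean, the initial biases are at
least one, and the reweighting functions are bounded, non-decreasing and Lipschitz on `(0, 1]`. -/
structure IsAdmissible : Prop where
  isProbabilityMeasure : ∀ i, IsProbabilityMeasure (E.ν i)
  integrable : ∀ i, Integrable (fun x : ℝ => x) (E.ν i)
  one_le_T0 : ∀ i, 1 ≤ E.T0 i
  bounded : ∀ i, ∃ C : ℝ, ∀ x ∈ Ioc (0 : ℝ) 1, |E.f i x| ≤ C
  monotone : ∀ i, MonotoneOn (E.f i) (Ioc 0 1)
  lipschitz : ∃ L : NNReal, ∀ i, LipschitzOnWith L (E.f i) (Ioc 0 1)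

/-- Every arm has a Bernoulli law on `{0, 1}`. -/
def IsBernoulli : Prop :=
  ∀ i, ∃ p : unitInterval, E.ν i = bernoulliMeasure (1 : ℝ) 0 p

/-- The bias `f i ((T0 i + m) / ((∑ j, T0 j) + t))` with which arm `i` is observed in round `t + 1`,
when it has been played `m` times in the first `t` rounds. -/
def bias (i : Fin K) (m t : ℕ) : ℝ :=
  E.f i ((E.T0 i + m) / ((∑ j, E.T0 j) + t))

end BiasedBandit

section Interaction

variable {K : ℕ} {Ω : Type*}

/-- The number of times that arm `i` is played in rounds `1, …, n`. -/
def pulls (A : ℕ → Ω → Fin K) (i : Fin K) (n : ℕ) (ω : Ω) : ℕ :=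
  ((Finset.Icc 1 n).filter fun t => A t ω = i).card

/-- The empirical mean of the feedback received from arm `i` in rounds `1, …, n`. -/
def empMean (A : ℕ → Ω → Fin K) (Y : ℕ → Ω → ℝ) (i : Fin K) (n : ℕ) (ω : Ω) : ℝ :=
  (∑ s ∈ Finset.Icc 1 n, if A s ω = i then Y s ω else 0) / pulls A i n ω

/-- The upper confidence index of arm `i` that is used in round `t` (for `t > K`). -/
def ucbIndex (A : ℕ → Ω → Fin K) (Y : ℕ → Ω → ℝ) (i : Fin K) (t : ℕ) (ω : Ω) : ℝ :=
  empMean A Y i (t - 1) ω + √(2 * Real.log t / pulls A i (t - 1) ω)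

variable [mΩ : MeasurableSpace Ω]

/-- A run of some bandit policy in the biased environment `E`, on a probability space with a
filtration `ℱ`. In round `t ≥ 1` the policy plays arm `A t` and observes the feedback `Y t`;
`X i t` is the unobserved true reward of arm `i`. The values at `t = 0` play no role.
The `σ`-algebra `ℱ t` contains the observations of the first `t` rounds, and it may contain more:
any extra randomness that the policy uses to choose an arm, for instance to break ties. -/
structure IsBiasedRun (E : BiasedBandit K) (P : Measure Ω) (ℱ : Filtration ℕ mΩ)
    (A : ℕ → Ω → Fin K) (X : Fin K → ℕ → Ω → ℝ) (Y : ℕ → Ω → ℝ) : Prop where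
  isProbabilityMeasure : IsProbabilityMeasure P
  /-- the arm is chosen before the round -/
  measurable_arm : ∀ t, Measurable[ℱ t] (A (t + 1))
  measurable_feedback : ∀ t, Measurable[ℱ (t + 1)] (Y (t + 1))
  integrable_feedback : ∀ t, Integrable (Y (t + 1)) P
  hasLaw_reward : ∀ i t, HasLaw (X i (t + 1)) (E.ν i) P
  /-- the true rewards of a round are independent of the past and of the choice of the arm -/
  indep_reward : ∀ i t, Indep (MeasurableSpace.comap (X i (t + 1)) inferInstance) (ℱ t) P
  /-- the conditional mean of the feedback is the mean of the chosen arm times its bias -/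
  condExp_feedback : ∀ t, P[Y (t + 1) | ℱ t] =ᵐ[P]
    fun ω => E.mean (A (t + 1) ω) * E.bias (A (t + 1) ω) (pulls A (A (t + 1) ω) t ω) t
  /-- the feedback, centred at its conditional mean, is conditionally `1`-subgaussian -/
  subgaussian_feedback : ∀ t, ∀ l : ℝ,
    Integrable (fun ω => Real.exp (l * (Y (t + 1) ω - (P[Y (t + 1) | ℱ t]) ω))) P ∧
    P[fun ω => Real.exp (l * (Y (t + 1) ω - (P[Y (t + 1) | ℱ t]) ω)) | ℱ t]
      ≤ᵐ[P] fun _ => Real.exp (l ^ 2 / 2)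

/-- The feedback is Bernoulli: it takes the values `0` and `1` only. -/
def HasBernoulliFeedback (P : Measure Ω) (Y : ℕ → Ω → ℝ) : Prop :=
  ∀ t, ∀ᵐ ω ∂P, Y (t + 1) ω = 0 ∨ Y (t + 1) ω = 1

/-- The arms are chosen by UCB: each arm is played once in the first `K` rounds, in order, and from
then on an arm with the largest index is played. Ties may be broken in any way. -/
structure IsUCB (P : Measure Ω) (A : ℕ → Ω → Fin K) (Y : ℕ → Ω → ℝ) : Prop where
  initial : ∀ i : Fin K, ∀ᵐ ω ∂P, A (i + 1) ω = i
  argmax : ∀ t : ℕ, K < t → ∀ᵐ ω ∂P, ∀ i, ucbIndex A Y i t ω ≤ ucbIndex A Y (A t ω) t ω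

/-- A run of UCB, which ignores the bias, in the biased Bernoulli bandit `E`. -/
structure IsUCBRun (E : BiasedBandit K) (P : Measure Ω) (ℱ : Filtration ℕ mΩ)
    (A : ℕ → Ω → Fin K) (X : Fin K → ℕ → Ω → ℝ) (Y : ℕ → Ω → ℝ) : Prop where
  run : IsBiasedRun E P ℱ A X Y
  bernoulli : HasBernoulliFeedback P Y
  ucb : IsUCB P A Y

/-- The pseudo-regret after `n` rounds, measured with the true rewards. -/
def regret (P : Measure Ω) (A : ℕ → Ω → Fin K) (X : Fin K → ℕ → Ω → ℝ) (n : ℕ) : ℝ :=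
  ⨆ i : Fin K, ∫ ω, ∑ t ∈ Finset.Icc 1 n, (X i t ω - X (A t ω) t ω) ∂P

end Interaction

end AffinityBandit

end

/-!
The huge initial bias `T` of arm `1` makes the feedback of arm `0` almost always `0`, although its
true reward is better: after `k` pulls of arm `0` the next one is rewarded with probability
`9 / 10 * (10 + k) / (10 + T + t)`, where `T` exceeds two million. As long as arm `0` has never been
rewarded and the empirical mean of arm `1` is not far from `4 / 5`, UCB returns to arm `0` for its
exploration bonus only, hence makes its pull number `k + 1` not before a time exponential in `k`
(`IsTypical.pulls_of_arm_eq_zero`). So arm `0` is pulled `O(log t)` times, and its bias stays so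
small that, with high probability, it is never rewarded at all.

This circular argument is closed by one supermartingale, `potential`. A path is `Good` up to
time `t` if arm `0` has had no reward and the number of rewards of arm `1` is at least about two
thirds of the number of its pulls. On good paths the potential is the sum of

* `budget`, the sum of the bounds `hitBound k` on the success probabilities of the future pulls of
  arm `0`: a total of `1 / 200`, where the first `120` pulls are controlled by the size of `T`
  and the later ones by the exponential waiting times;
* `deficit`, an exponential supermartingale for the rewards of arm `1`, which starts at `2 ^ (-8)`
  and reaches `1` when the path fails to be good through arm `1`.

When a path fails to be good, the potential is set to `1` for ever. One step of the potential is
bounded by an affine function of the feedback, because the feedback is `0` or `1`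
(`IsTypical.potential_succ_le`), so only the conditional mean of the feedback matters
(`IsTypical.step_le_potential`). Hence a path fails to be good with probability at most
`1 / 256 + 1 / 200 ≤ 1 / 100`. Since arm `0` is pulled at most `n / 100` times on good paths, its
expected number of pulls is at most `n / 50`, and the regret, which is `1 / 10` for each pull of
arm `1`, is at least `0.098 * n`.

A run of UCB exists on a product space, in which every round draws a uniform variable, from which
the feedback is sampled by inversion, together with fresh true rewards (`isUCBRun_run`).
-/

namespace AffinityBandit

/-! ### Counting pulls and summing feedback -/

section Counting

variable {K : ℕ} {Ω : Type*} (A : ℕ → Ω → Fin K) (Y : ℕ → Ω → ℝ) (i : Fin K)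

/-- The total feedback received from arm `i` in rounds `1, …, n`. -/
noncomputable def feedbackSum (n : ℕ) (ω : Ω) : ℝ :=
  ∑ s ∈ Finset.Icc 1 n, if A s ω = i then Y s ω else 0

@[simp] lemma pulls_zero (ω : Ω) : pulls A i 0 ω = 0 := by simp [pulls]

@[simp] lemma feedbackSum_zero (ω : Ω) : feedbackSum A Y i 0 ω = 0 := by simp [feedbackSum]

lemma pulls_eq_sum (n : ℕ) (ω : Ω) :
    pulls A i n ω = ∑ s ∈ Finset.Icc 1 n, if A s ω = i then 1 else 0 := by
  rw [pulls, Finset.card_filter]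

lemma pulls_succ (n : ℕ) (ω : Ω) :
    pulls A i (n + 1) ω = pulls A i n ω + if A (n + 1) ω = i then 1 else 0 := by
  rw [pulls_eq_sum, pulls_eq_sum, Finset.sum_Icc_succ_top (by omega)]

lemma feedbackSum_succ (n : ℕ) (ω : Ω) :
    feedbackSum A Y i (n + 1) ω =
      feedbackSum A Y i n ω + if A (n + 1) ω = i then Y (n + 1) ω else 0 := by
  rw [feedbackSum, feedbackSum, Finset.sum_Icc_succ_top (by omega)]

lemma pulls_le (n : ℕ) (ω : Ω) : pulls A i n ω ≤ n := by
  exact (Finset.card_filter_le _ _).trans (by simp)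

lemma pulls_mono (ω : Ω) : Monotone fun n => pulls A i n ω :=
  monotone_nat_of_le_succ fun n => by rw [pulls_succ]; omega

lemma pulls_zero_add_pulls_one (A : ℕ → Ω → Fin 2) (n : ℕ) (ω : Ω) :
    pulls A 0 n ω + pulls A 1 n ω = n := by
  induction n with
  | zero => simp
  | succ n ih =>
    rw [pulls_succ, pulls_succ]
    have h : A (n + 1) ω = 0 ∨ A (n + 1) ω = 1 := by omega
    rcases h with h | h <;> simp [h] <;> omega

lemma empMean_eq (n : ℕ) (ω : Ω) :
    empMean A Y i n ω = feedbackSum A Y i n ω / pulls A i n ω := rfl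

end Counting

/-! ### The budget of the first arm -/

/-- An upper bound for the probability that the pull number `k + 1` of the first arm is rewarded.
The first `120` pulls are controlled by the initial bias of the other arm, which exceeds
`2000000`, the later ones by the exponentially long time that UCB waits before it makes them. -/
noncomputable def hitBound (k : ℕ) : ℝ :=
  if k < 120 then (10 + k) / 2000000 else Real.exp (-(k : ℝ) / 12)

lemma exp_ten_ge : (22000 : ℝ) ≤ Real.exp 10 := by
  have h := Real.exp_one_gt_d9
  have h2 : Real.exp 10 = Real.exp 1 ^ 10 := by rw [← Real.exp_nat_mul]; norm_num
  rw [h2]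
  calc (22000 : ℝ) ≤ 2.718 ^ 10 := by norm_num
    _ ≤ _ := by gcongr; linarith

/-- This makes the tail of `hitBound` telescope, since `exp (-m / 12)` is at most
`13 * (exp (-m / 12) - exp (-(m + 1) / 12))`. -/
lemma exp_neg_inv_twelve_le : Real.exp (-1 / 12) ≤ 12 / 13 := by
  have h : (13 / 12 : ℝ) ≤ Real.exp (1 / 12) := by
    have := Real.add_one_le_exp (1 / 12 : ℝ); linarith
  rw [show (-1 / 12 : ℝ) = -(1 / 12) by ring, Real.exp_neg,
    inv_le_comm₀ (by positivity) (by norm_num)]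
  linarith

lemma hitBound_nonneg (k : ℕ) : 0 ≤ hitBound k := by
  unfold hitBound; split_ifs <;> positivity

lemma sum_hitBound_lt {k : ℕ} (hk : k ≤ 120) :
    ∑ j ∈ Finset.range k, hitBound j = (19 * k + k ^ 2) / 4000000 := by
  induction k with
  | zero => simp
  | succ k ih =>
    rw [Finset.sum_range_succ, ih (by omega), hitBound, if_pos (by omega)]
    push_cast; ring

lemma sum_hitBound_add (m : ℕ) :
    ∑ j ∈ Finset.range (120 + m), hitBound j ≤
      417 / 100000 + 13 * Real.exp (-10) - 13 * Real.exp (-((120 + m : ℕ) : ℝ) / 12) := by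
  induction m with
  | zero =>
    rw [sum_hitBound_lt (by omega)]
    norm_num
  | succ m ih =>
    rw [← add_assoc, Finset.sum_range_succ, hitBound, if_neg (by omega)]
    have h : Real.exp (-((120 + m + 1 : ℕ) : ℝ) / 12) ≤
        12 / 13 * Real.exp (-((120 + m : ℕ) : ℝ) / 12) := by
      rw [show -((120 + m + 1 : ℕ) : ℝ) / 12 = -1 / 12 + -((120 + m : ℕ) : ℝ) / 12 by
        push_cast; ring, Real.exp_add]
      gcongr
      exact exp_neg_inv_twelve_le
    linarith

lemma sum_hitBound_le (k : ℕ) : ∑ j ∈ Finset.range k, hitBound j ≤ 1 / 200 := by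
  have h1 : ∑ j ∈ Finset.range k, hitBound j ≤ ∑ j ∈ Finset.range (120 + k), hitBound j :=
    Finset.sum_le_sum_of_subset_of_nonneg (Finset.range_mono (by omega))
      fun j _ _ => hitBound_nonneg j
  have h2 := sum_hitBound_add k
  have h3 : Real.exp (-10) ≤ 1 / 22000 := by
    rw [Real.exp_neg, inv_le_comm₀ (by positivity) (by norm_num)]
    have := exp_ten_ge
    linarith
  have h4 := Real.exp_pos (-((120 + k : ℕ) : ℝ) / 12)
  linarith

/-- The part of the total budget `1 / 200` for rewards of the first arm that is left after `k`
of its pulls. -/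
noncomputable def budget (k : ℕ) : ℝ := 1 / 200 - ∑ j ∈ Finset.range k, hitBound j

lemma budget_nonneg (k : ℕ) : 0 ≤ budget k := sub_nonneg.2 (sum_hitBound_le k)

lemma budget_le (k : ℕ) : budget k ≤ 1 :=
  by have := Finset.sum_nonneg fun j (_ : j ∈ Finset.range k) => hitBound_nonneg j
     unfold budget; linarith

lemma budget_succ (k : ℕ) : budget (k + 1) = budget k - hitBound k := by
  rw [budget, budget, Finset.sum_range_succ]; ring

/-- The success probability of a pull of the first arm after `k` pulls, in round `t + 1`, is at most
`hitBound k` if the round is late enough. -/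
lemma div_le_hitBound {k t : ℕ} {S : ℝ} (hS : 2000000 ≤ S)
    (h : k < 120 ∨ Real.exp (k / 6) ≤ t + 1) :
    9 / 10 * ((10 + k) / (S + t)) ≤ hitBound k := by
  have ht : (0 : ℝ) ≤ t := t.cast_nonneg
  have hk0 : (0 : ℝ) ≤ k := k.cast_nonneg
  have h0 : (0 : ℝ) ≤ (10 + k) / (S + t) := div_nonneg (by linarith) (by linarith)
  have h1 : 9 / 10 * ((10 + k) / (S + t)) ≤ (10 + k) / (S + t) := by linarith
  refine h1.trans ?_
  unfold hitBound
  split_ifs with hk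
  · gcongr; linarith
  · have h := h.resolve_left hk
    have hk' : (120 : ℝ) ≤ k := by exact_mod_cast not_lt.1 hk
    -- half of the exponent `k / 6` of the waiting time absorbs the factor `10 + k`
    have h2 : (10 + k : ℝ) ≤ Real.exp (k / 12) := by
      have h3 : Real.exp ((k : ℝ) / 12) = Real.exp 10 * Real.exp (((k : ℝ) - 120) / 12) := by
        rw [← Real.exp_add]; congr 1; ring
      have h4 := Real.add_one_le_exp (((k : ℝ) - 120) / 12)
      have h5 := exp_ten_ge
      rw [h3]
      have h6 : 22000 * (((k : ℝ) - 120) / 12 + 1) ≤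
          Real.exp 10 * Real.exp (((k : ℝ) - 120) / 12) :=
        mul_le_mul h5 h4 (by linarith) (by positivity)
      linarith
    rw [div_le_iff₀ (by linarith)]
    calc (10 + k : ℝ) ≤ Real.exp (k / 12) := h2
      _ = Real.exp (-k / 12) * Real.exp (k / 6) := by rw [← Real.exp_add]; congr 1; ring
      _ ≤ Real.exp (-k / 12) * (S + t) := by gcongr; linarith

/-! ### Typical paths -/

section Path

variable {Ω : Type*}

/-- The sample point satisfies all the almost sure properties of UCB with two arms and Bernoulli
feedback. -/
structure IsTypical (A : ℕ → Ω → Fin 2) (Y : ℕ → Ω → ℝ) (ω : Ω) : Prop where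
  first : A 1 ω = 0
  second : A 2 ω = 1
  feedback : ∀ t, Y (t + 1) ω = 0 ∨ Y (t + 1) ω = 1
  argmax : ∀ t, 2 < t → ∀ i, ucbIndex A Y i t ω ≤ ucbIndex A Y (A t ω) t ω

/-- Up to round `t` the first arm has never been rewarded, and the second one has been rewarded in
about two thirds of its pulls at least; the slack `8` allows for the fluctuations of the first few
pulls. -/
def Good (A : ℕ → Ω → Fin 2) (Y : ℕ → Ω → ℝ) (t : ℕ) (ω : Ω) : Prop :=
  ∀ s ≤ t, feedbackSum A Y 0 s ω = 0 ∧ 2 / 3 * (pulls A 1 s ω : ℝ) - feedbackSum A Y 1 s ω < 8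

variable {A : ℕ → Ω → Fin 2} {Y : ℕ → Ω → ℝ} {ω : Ω}

lemma Good.mono {s t : ℕ} (h : Good A Y t ω) (hst : s ≤ t) : Good A Y s ω :=
  fun u hu => h u (hu.trans hst)

lemma good_succ_iff {t : ℕ} : Good A Y (t + 1) ω ↔ Good A Y t ω ∧
    (feedbackSum A Y 0 (t + 1) ω = 0 ∧
      2 / 3 * (pulls A 1 (t + 1) ω : ℝ) - feedbackSum A Y 1 (t + 1) ω < 8) := by
  constructor
  · exact fun h => ⟨h.mono t.le_succ, h _ le_rfl⟩
  · rintro ⟨h1, h2⟩ s hs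
    rcases Nat.le_succ_iff.1 hs with hs | rfl
    exacts [h1 s hs, h2]

lemma good_zero : Good A Y 0 ω := by
  intro s hs
  obtain rfl : s = 0 := by omega
  simp

namespace IsTypical

lemma feedbackSum_nonneg (h : IsTypical A Y ω) (i : Fin 2) (t : ℕ) :
    0 ≤ feedbackSum A Y i t ω := by
  induction t with
  | zero => simp
  | succ t ih =>
    rw [feedbackSum_succ]
    rcases h.feedback t with h | h <;> split_ifs <;> linarith

lemma pulls_pos (h : IsTypical A Y ω) (i : Fin 2) {t : ℕ} (ht : 2 ≤ t) : 0 < pulls A i t ω := by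
  refine lt_of_lt_of_le ?_ (pulls_mono A i ω ht)
  change 0 < pulls A i (0 + 1 + 1) ω
  have hi : i = 0 ∨ i = 1 := by omega
  rcases hi with rfl | rfl <;> simp [pulls_succ, h.first, h.second]

/-- On a good path UCB waits exponentially long before it returns to the first arm: an
unrewarded arm with `k` pulls only wins by its exploration bonus, and that bonus has to reach
the empirical mean of the second arm, which is at least `3 / 5` as soon as the second arm has
`120` pulls. -/
lemma pulls_of_arm_eq_zero (h : IsTypical A Y ω) {t : ℕ} (hg : Good A Y t ω)
    (hA : A (t + 1) ω = 0) :
    pulls A 0 t ω < 120 ∨ Real.exp (pulls A 0 t ω / 6) ≤ t + 1 := by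
  by_cases ht : 2 ≤ t
  swap
  · left
    have := pulls_le A 0 t ω
    omega
  rw [or_iff_not_imp_left, not_lt]
  intro hk
  have hmax := h.argmax (t + 1) (by omega) 1
  obtain ⟨hS0, hS1⟩ := hg t le_rfl
  rw [hA, ucbIndex, ucbIndex, empMean_eq, empMean_eq, Nat.add_sub_cancel, hS0, zero_div,
    zero_add] at hmax
  have hp0 : (0 : ℝ) < pulls A 0 t ω := by exact_mod_cast h.pulls_pos 0 ht
  have hp1 : (0 : ℝ) < pulls A 1 t ω := by exact_mod_cast h.pulls_pos 1 ht
  have hS1' := h.feedbackSum_nonneg 1 t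
  set k := (pulls A 0 t ω : ℝ) with hkdef
  set m := (pulls A 1 t ω : ℝ)
  set L := Real.log ((t + 1 : ℕ) : ℝ) with hL
  have hLpos : 0 < L := Real.log_pos (by push_cast; have : (2 : ℝ) ≤ t := by exact_mod_cast ht
                                         linarith)
  have hk' : (120 : ℝ) ≤ k := by simp only [hkdef]; exact_mod_cast hk
  -- the bonus of the first arm dominates that of the second one, which therefore has more pulls
  have hkm : k ≤ m := by
    have h1 : √(2 * L / m) ≤ √(2 * L / k) := by
      have : 0 ≤ feedbackSum A Y 1 t ω / m := by positivity
      linarith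
    rw [Real.sqrt_le_sqrt_iff (by positivity)] at h1
    rwa [div_le_div_iff_of_pos_left (by positivity) hp1 hp0] at h1
  have hmean : (3 / 5 : ℝ) ≤ √(2 * L / k) := by
    have h1 : 3 / 5 ≤ feedbackSum A Y 1 t ω / m := by
      rw [le_div_iff₀ hp1]; linarith
    have := Real.sqrt_nonneg (2 * L / m)
    linarith
  rw [Real.le_sqrt' (by norm_num), le_div_iff₀ hp0] at hmean
  rw [← Real.le_log_iff_exp_le (by positivity)]
  have : Real.log ((t : ℝ) + 1) = L := by rw [hL]; push_cast; rfl
  rw [this]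
  linarith

/-- On a good path the first arm is pulled at most logarithmically often. -/
lemma pulls_zero_le (h : IsTypical A Y ω) {t : ℕ} (hg : Good A Y t ω) :
    pulls A 0 t ω ≤ 120 ∨ Real.exp (((pulls A 0 t ω : ℝ) - 1) / 6) ≤ t := by
  induction t with
  | zero => simp
  | succ t ih =>
    have hg' := hg.mono t.le_succ
    rw [pulls_succ]
    split_ifs with hA
    · rcases h.pulls_of_arm_eq_zero hg' hA with h1 | h1
      · left; omega
      · right; push_cast; rw [add_sub_cancel_right]; exact h1
    · rcases ih hg' with h1 | h1
      · left; omega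
      · right; push_cast; rw [add_zero]; linarith

lemma pulls_zero_le_log (h : IsTypical A Y ω) {t : ℕ} (hg : Good A Y t ω) :
    pulls A 0 t ω ≤ 120 ∨ (0 < t ∧ (pulls A 0 t ω : ℝ) ≤ 1 + 6 * Real.log t) := by
  rcases h.pulls_zero_le hg with h1 | h1
  · exact .inl h1
  · have ht : (0 : ℝ) < t := (Real.exp_pos _).trans_le h1
    rw [← Real.le_log_iff_exp_le ht] at h1
    exact .inr ⟨by exact_mod_cast ht, by linarith⟩

/-- On a good path the first arm is pulled so rarely that the second one keeps at least `15 / 16`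
of the total bias, and is therefore rewarded with probability at least `3 / 4`. -/
lemma sixteen_mul_pulls_le (h : IsTypical A Y ω) {t : ℕ} (hg : Good A Y t ω) :
    16 * (10 + (pulls A 0 t ω : ℝ)) ≤ 2000000 + t := by
  have ht0 : (0 : ℝ) ≤ t := t.cast_nonneg
  rcases h.pulls_zero_le_log hg with h1 | ⟨ht, h1⟩
  · have : (pulls A 0 t ω : ℝ) ≤ 120 := by exact_mod_cast h1
    linarith
  · have ht : (0 : ℝ) < t := by exact_mod_cast ht
    have h2 := Real.add_one_le_exp (Real.log t - 10)
    -- a tangent of the logarithm, at the point `exp 10`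
    rw [Real.exp_sub, Real.exp_log ht] at h2
    have h3 : (t : ℝ) / Real.exp 10 ≤ t / 22000 := by gcongr; exact exp_ten_ge
    linarith

lemma pulls_zero_le_div (h : IsTypical A Y ω) {n : ℕ} (hn : 16207 ≤ n) (hg : Good A Y n ω) :
    (pulls A 0 n ω : ℝ) ≤ n / 100 := by
  have hn' : (16207 : ℝ) ≤ n := by exact_mod_cast hn
  rcases h.pulls_zero_le_log hg with h1 | ⟨_, h1⟩
  · have : (pulls A 0 n ω : ℝ) ≤ 120 := by exact_mod_cast h1
    linarith
  · have h2 := Real.add_one_le_exp (Real.log n - 10)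
    rw [Real.exp_sub, Real.exp_log (by linarith)] at h2
    have h3 : (n : ℝ) / Real.exp 10 ≤ n / 22000 := by gcongr; exact exp_ten_ge
    linarith

end IsTypical

/-! ### The potential -/

/-- The exponential deficit of the rewards of the second arm. It is less than `1` exactly if the
condition of `Good` on the second arm holds. -/
noncomputable def deficit (A : ℕ → Ω → Fin 2) (Y : ℕ → Ω → ℝ) (t : ℕ) (ω : Ω) : ℝ :=
  2 ^ (2 / 3 * (pulls A 1 t ω : ℝ) - feedbackSum A Y 1 t ω - 8)

open Classical in
/-- The potential: on good paths the exponential deficit of the second arm plus the remaining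
budget of the first one, and `1` from the first round on in which the path fails to be good. -/
noncomputable def potential (A : ℕ → Ω → Fin 2) (Y : ℕ → Ω → ℝ) (t : ℕ) (ω : Ω) : ℝ :=
  if Good A Y t ω then deficit A Y t ω + budget (pulls A 0 t ω) else 1

open Classical in
/-- The constant coefficient of an affine bound for `potential A Y (t + 1)` in terms of the
feedback `Y (t + 1)`. -/
noncomputable def stepConst (A : ℕ → Ω → Fin 2) (Y : ℕ → Ω → ℝ) (t : ℕ) (ω : Ω) : ℝ :=
  if Good A Y t ω then
    if A (t + 1) ω = 0 then deficit A Y t ω + budget (pulls A 0 t ω + 1)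
    else 8 / 5 * deficit A Y t ω + budget (pulls A 0 t ω)
  else 1

open Classical in
/-- The slope of an affine bound for `potential A Y (t + 1)` in terms of the feedback
`Y (t + 1)`. -/
noncomputable def stepSlope (A : ℕ → Ω → Fin 2) (Y : ℕ → Ω → ℝ) (t : ℕ) (ω : Ω) : ℝ :=
  if Good A Y t ω then if A (t + 1) ω = 0 then 1 else -(4 / 5) * deficit A Y t ω else 0

lemma deficit_pos (t : ℕ) (ω : Ω) : 0 < deficit A Y t ω := Real.rpow_pos_of_pos two_pos _

lemma potential_nonneg (t : ℕ) (ω : Ω) : 0 ≤ potential A Y t ω := by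
  unfold potential
  split_ifs
  · have := deficit_pos (A := A) (Y := Y) t ω
    have := budget_nonneg (pulls A 0 t ω)
    linarith
  · norm_num

/-- A pull of the second arm multiplies its deficit by `2 ^ (2 / 3)`, and a reward halves it. -/
lemma two_rpow_le : (2 : ℝ) ^ (2 / 3 : ℝ) ≤ 8 / 5 := by
  rw [show (2 / 3 : ℝ) = 2 * (3 : ℝ)⁻¹ by norm_num, Real.rpow_mul (by norm_num),
    Real.rpow_inv_le_iff_of_pos (by positivity) (by norm_num) (by norm_num)]
  norm_num

namespace IsTypical

lemma deficit_succ_of_arm_eq_zero {t : ℕ} (hA : A (t + 1) ω = 0) :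
    deficit A Y (t + 1) ω = deficit A Y t ω := by
  simp [deficit, pulls_succ, feedbackSum_succ, hA]

lemma deficit_succ_le (h : IsTypical A Y ω) {t : ℕ} (hA : A (t + 1) ω = 1) :
    deficit A Y (t + 1) ω ≤ 8 / 5 * deficit A Y t ω - 4 / 5 * deficit A Y t ω * Y (t + 1) ω := by
  have hd := deficit_pos (A := A) (Y := Y) t ω
  have key : deficit A Y (t + 1) ω =
      deficit A Y t ω * (2 : ℝ) ^ (2 / 3 : ℝ) * (2 : ℝ) ^ (-Y (t + 1) ω) := by
    rw [deficit, deficit, ← Real.rpow_add two_pos, ← Real.rpow_add two_pos, pulls_succ,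
      feedbackSum_succ, if_pos hA, if_pos hA]
    congr 1
    push_cast
    ring
  rw [key]
  have h2 := mul_le_mul_of_nonneg_left two_rpow_le hd.le
  rcases h.feedback t with hY | hY <;> rw [hY]
  · simp only [neg_zero, Real.rpow_zero]; linarith
  · rw [Real.rpow_neg_one]; linarith

lemma potential_succ_le (h : IsTypical A Y ω) (t : ℕ) :
    potential A Y (t + 1) ω ≤ stepConst A Y t ω + stepSlope A Y t ω * Y (t + 1) ω := by
  unfold stepConst stepSlope
  by_cases hg : Good A Y t ω
  swap
  · have : ¬ Good A Y (t + 1) ω := fun h => hg (h.mono t.le_succ)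
    simp [potential, hg, this]
  have hd := deficit_pos (A := A) (Y := Y) t ω
  have hcases : A (t + 1) ω = 0 ∨ A (t + 1) ω = 1 := by omega
  rcases hcases with hA | hA
  · simp only [if_pos hg, if_pos hA, one_mul]
    have hb := budget_nonneg (pulls A 0 t ω + 1)
    by_cases hg' : Good A Y (t + 1) ω
    · have hY : 0 ≤ Y (t + 1) ω := by rcases h.feedback t with h | h <;> rw [h]; norm_num
      rw [potential, if_pos hg', deficit_succ_of_arm_eq_zero hA, pulls_succ, if_pos hA]
      linarith
    · rw [potential, if_neg hg']
      rcases h.feedback t with hY | hY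
      · refine absurd (good_succ_iff.2 ⟨hg, ?_⟩) hg'
        simpa [pulls_succ, feedbackSum_succ, hA, hY] using hg t le_rfl
      · linarith
  · have hA0 : ¬ A (t + 1) ω = 0 := by simp [hA]
    simp only [if_pos hg, if_neg hA0]
    have hb := budget_nonneg (pulls A 0 t ω)
    have hstep := h.deficit_succ_le hA
    have hle : potential A Y (t + 1) ω ≤ deficit A Y (t + 1) ω + budget (pulls A 0 t ω) := by
      unfold potential
      split_ifs with hg'
      · rw [pulls_succ, if_neg hA0, add_zero]
      · -- the path can only have failed because the deficit of the second arm has reached `1`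
        have : 1 ≤ deficit A Y (t + 1) ω := by
          refine Real.one_le_rpow (by norm_num) ?_
          by_contra! hlt
          refine hg' (good_succ_iff.2 ⟨hg, ?_, by linarith⟩)
          rw [feedbackSum_succ, if_neg hA0, add_zero]
          exact (hg t le_rfl).1
        linarith
    linarith

end IsTypical

/-- The success probability of arm `i` in round `t + 1`, when it has been pulled `m` times in the
first `t` rounds, for means `9 / 10` and `4 / 5`, initial biases `10` and `T`, and the
identity as reweighting function. -/
noncomputable def successProb (T : ℝ) (i : Fin 2) (m t : ℕ) : ℝ :=
  if i = 0 then 9 / 10 * ((10 + m) / (10 + T + t)) else 4 / 5 * ((T + m) / (10 + T + t))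

/-- The affine bound, evaluated at the conditional mean of the feedback, does not exceed the current
potential: a pull of the first arm is paid for by its budget, and a pull of the second arm is
rewarded with probability at least `3 / 4`, so that its deficit does not grow on average. -/
lemma IsTypical.step_le_potential (h : IsTypical A Y ω) {T : ℝ} (hT : 2000000 ≤ T) (t : ℕ) :
    stepConst A Y t ω + stepSlope A Y t ω *
      successProb T (A (t + 1) ω) (pulls A (A (t + 1) ω) t ω) t ≤ potential A Y t ω := by
  unfold stepConst stepSlope potential
  by_cases hg : Good A Y t ω
  swap
  · simp [hg]
  have hd := deficit_pos (A := A) (Y := Y) t ω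
  have hcases : A (t + 1) ω = 0 ∨ A (t + 1) ω = 1 := by omega
  rcases hcases with hA | hA
  · have hq := div_le_hitBound (S := 10 + T) (by linarith) (h.pulls_of_arm_eq_zero hg hA)
    simp only [if_pos hg, hA, if_true, successProb, budget_succ]
    linarith
  · have hsum : (pulls A 0 t ω : ℝ) + pulls A 1 t ω = t := by
      exact_mod_cast pulls_zero_add_pulls_one A t ω
    have h16 := h.sixteen_mul_pulls_le hg
    have ht : (0 : ℝ) ≤ t := t.cast_nonneg
    have hp : 3 / 4 ≤ 4 / 5 * ((T + pulls A 1 t ω) / (10 + T + t)) := by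
      rw [mul_div_assoc', le_div_iff₀ (by linarith)]
      linarith
    simp only [if_pos hg, hA, one_ne_zero, if_false, successProb]
    have := mul_le_mul_of_nonneg_left hp hd.le
    linarith

/-- Pathwise, the number of pulls of the first arm is controlled by the potential. -/
lemma IsTypical.pulls_zero_le_potential (h : IsTypical A Y ω) {n : ℕ} (hn : 16207 ≤ n) :
    (pulls A 0 n ω : ℝ) ≤ n / 100 + n * potential A Y n ω := by
  have hn0 : (0 : ℝ) ≤ n := n.cast_nonneg
  by_cases hg : Good A Y n ω
  · have := h.pulls_zero_le_div hn hg
    have := mul_nonneg hn0 (potential_nonneg (A := A) (Y := Y) n ω)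
    linarith
  · have : (pulls A 0 n ω : ℝ) ≤ n := by exact_mod_cast pulls_le A 0 n ω
    rw [potential, if_neg hg]
    linarith

lemma potential_zero (ω : Ω) : potential A Y 0 ω = 1 / 256 + 1 / 200 := by
  rw [potential, if_pos good_zero, deficit, budget]
  simp only [pulls_zero, feedbackSum_zero, Finset.range_zero, Finset.sum_empty]
  rw [show (2 / 3 * ((0 : ℕ) : ℝ) - 0 - 8) = -((8 : ℕ) : ℝ) by norm_num,
    Real.rpow_neg (by norm_num), Real.rpow_natCast]
  norm_num

end Path

/-! ### The bandit instance -/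

/-- The instance in which UCB fails: Bernoulli arms with means `9 / 10` and `4 / 5`, the
identity as reweighting function, and a huge initial bias towards the second arm. -/
noncomputable def hardInstance : BiasedBandit 2 where
  ν := ![bernoulliMeasure 1 0 ⟨9 / 10, by norm_num, by norm_num⟩,
    bernoulliMeasure 1 0 ⟨4 / 5, by norm_num, by norm_num⟩]
  f := fun _ x => x
  T0 := ![10, (16216 : ℝ) ^ (1.5 : ℝ)]

lemma two_million_le_rpow : (2000000 : ℝ) ≤ (16216 : ℝ) ^ (1.5 : ℝ) := by
  have h : (16216 : ℝ) ^ (1.5 : ℝ) = 16216 * √16216 := by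
    rw [show (1.5 : ℝ) = 1 + 1 / 2 by norm_num, Real.rpow_add (by norm_num), Real.rpow_one,
      Real.sqrt_eq_rpow]
  have h2 : (127 : ℝ) ≤ √16216 := Real.le_sqrt_of_sq_le (by norm_num)
  rw [h]
  linarith

lemma hardInstance_mean_zero : hardInstance.mean 0 = 9 / 10 := by
  simp [BiasedBandit.mean, hardInstance, integral_bernoulliMeasure]

lemma hardInstance_mean_one : hardInstance.mean 1 = 4 / 5 := by
  simp [BiasedBandit.mean, hardInstance, integral_bernoulliMeasure]

lemma hardInstance_isBernoulli : hardInstance.IsBernoulli := by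
  intro i
  fin_cases i
  exacts [⟨_, rfl⟩, ⟨_, rfl⟩]

lemma hardInstance_mean_mul_bias (i : Fin 2) (m t : ℕ) :
    hardInstance.mean i * hardInstance.bias i m t =
      successProb ((16216 : ℝ) ^ (1.5 : ℝ)) i m t := by
  have hi : i = 0 ∨ i = 1 := by omega
  rcases hi with rfl | rfl
  · rw [hardInstance_mean_zero]
    simp [BiasedBandit.bias, hardInstance, successProb]
  · rw [hardInstance_mean_one]
    simp [BiasedBandit.bias, hardInstance, successProb]

lemma hardInstance_isAdmissible : hardInstance.IsAdmissible where
  isProbabilityMeasure i := by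
    obtain ⟨p, hp⟩ := hardInstance_isBernoulli i
    rw [hp]; infer_instance
  integrable i := by
    obtain ⟨p, hp⟩ := hardInstance_isBernoulli i
    rw [hp]; exact integrable_bernoulliMeasure ..
  one_le_T0 i := by
    have := two_million_le_rpow
    fin_cases i
    · simp [hardInstance]
    · simp only [hardInstance]
      change (1 : ℝ) ≤ (16216 : ℝ) ^ (1.5 : ℝ)
      linarith
  bounded _ := ⟨1, fun x hx => (abs_of_pos hx.1).trans_le hx.2⟩
  monotone _ := monotoneOn_id
  lipschitz := ⟨1, fun _ => LipschitzWith.id.lipschitzOnWith⟩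

/-! ### Measurability and bounds -/

section Measurability

variable {Ω : Type*} {m : MeasurableSpace Ω} {A : ℕ → Ω → Fin 2} {Y : ℕ → Ω → ℝ} {t : ℕ}

lemma measurable_pulls (hA : ∀ s, 1 ≤ s → s ≤ t → Measurable (A s)) (i : Fin 2) :
    Measurable (pulls A i t) := by
  rw [show pulls A i t = fun ω => ∑ s ∈ Finset.Icc 1 t, if A s ω = i then 1 else 0 from
    funext fun ω => pulls_eq_sum A i t ω]
  refine Finset.measurable_sum _ fun s hs => Measurable.ite ?_ measurable_const measurable_const
  rw [Finset.mem_Icc] at hs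
  exact hA s hs.1 hs.2 (measurableSet_singleton i)

lemma measurable_feedbackSum (hA : ∀ s, 1 ≤ s → s ≤ t → Measurable (A s))
    (hY : ∀ s, 1 ≤ s → s ≤ t → Measurable (Y s)) (i : Fin 2) :
    Measurable (feedbackSum A Y i t) := by
  refine Finset.measurable_sum _ fun s hs => ?_
  rw [Finset.mem_Icc] at hs
  exact Measurable.ite (hA s hs.1 hs.2 (measurableSet_singleton i)) (hY s hs.1 hs.2)
    measurable_const

lemma measurable_deficit (hA : ∀ s, 1 ≤ s → s ≤ t → Measurable (A s))
    (hY : ∀ s, 1 ≤ s → s ≤ t → Measurable (Y s)) : Measurable (deficit A Y t) := by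
  have h1 := measurable_pulls hA 1
  have h2 := measurable_feedbackSum hA hY 1
  unfold deficit
  fun_prop

lemma measurableSet_good (hA : ∀ s, 1 ≤ s → s ≤ t → Measurable (A s))
    (hY : ∀ s, 1 ≤ s → s ≤ t → Measurable (Y s)) : MeasurableSet {ω | Good A Y t ω} := by
  simp only [Good, ofPred_forall]
  refine MeasurableSet.iInter fun s => MeasurableSet.iInter fun hs => ?_
  have hA' : ∀ u, 1 ≤ u → u ≤ s → Measurable (A u) := fun u h1 h2 => hA u h1 (h2.trans hs)
  have hY' : ∀ u, 1 ≤ u → u ≤ s → Measurable (Y u) := fun u h1 h2 => hY u h1 (h2.trans hs)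
  have h1 := measurable_pulls hA' 1
  have h2 := measurable_feedbackSum hA' hY'
  have h3 := h2 1
  have h4 : Measurable fun ω => 2 / 3 * (pulls A 1 s ω : ℝ) - feedbackSum A Y 1 s ω := by fun_prop
  exact ((h2 0) (measurableSet_singleton 0)).inter (h4 measurableSet_Iio)

lemma measurable_potential (hA : ∀ s, 1 ≤ s → s ≤ t → Measurable (A s))
    (hY : ∀ s, 1 ≤ s → s ≤ t → Measurable (Y s)) : Measurable (potential A Y t) :=
  Measurable.ite (measurableSet_good hA hY)
    ((measurable_deficit hA hY).add
      ((measurable_of_countable budget).comp (measurable_pulls hA 0))) measurable_const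

lemma measurable_stepConst (hA : ∀ s, 1 ≤ s → s ≤ t + 1 → Measurable (A s))
    (hY : ∀ s, 1 ≤ s → s ≤ t → Measurable (Y s)) : Measurable (stepConst A Y t) := by
  have hA' : ∀ s, 1 ≤ s → s ≤ t → Measurable (A s) := fun s h1 h2 => hA s h1 (by omega)
  refine Measurable.ite (measurableSet_good hA' hY) (Measurable.ite
    (hA (t + 1) (by omega) le_rfl (measurableSet_singleton 0)) ?_ ?_) measurable_const
  · exact (measurable_deficit hA' hY).add
      ((measurable_of_countable fun k => budget (k + 1)).comp (measurable_pulls hA' 0))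
  · exact ((measurable_deficit hA' hY).const_mul _).add
      ((measurable_of_countable budget).comp (measurable_pulls hA' 0))

lemma measurable_stepSlope (hA : ∀ s, 1 ≤ s → s ≤ t + 1 → Measurable (A s))
    (hY : ∀ s, 1 ≤ s → s ≤ t → Measurable (Y s)) : Measurable (stepSlope A Y t) := by
  have hA' : ∀ s, 1 ≤ s → s ≤ t → Measurable (A s) := fun s h1 h2 => hA s h1 (by omega)
  exact Measurable.ite (measurableSet_good hA' hY) (Measurable.ite
    (hA (t + 1) (by omega) le_rfl (measurableSet_singleton 0)) measurable_const
    ((measurable_deficit hA' hY).const_mul _)) measurable_const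

end Measurability

section Bounds

variable {Ω : Type*} {A : ℕ → Ω → Fin 2} {Y : ℕ → Ω → ℝ} {ω : Ω}

namespace IsTypical

lemma deficit_le (h : IsTypical A Y ω) (t : ℕ) : deficit A Y t ω ≤ 2 ^ t := by
  rw [← Real.rpow_natCast]
  refine Real.rpow_le_rpow_of_exponent_le (by norm_num) ?_
  have h1 : (pulls A 1 t ω : ℝ) ≤ t := by exact_mod_cast pulls_le A 1 t ω
  have h2 := h.feedbackSum_nonneg 1 t
  have h3 : (0 : ℝ) ≤ t := t.cast_nonneg
  linarith

lemma norm_potential_le (h : IsTypical A Y ω) (t : ℕ) : ‖potential A Y t ω‖ ≤ 2 ^ t + 1 := by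
  rw [Real.norm_of_nonneg (potential_nonneg t ω), potential]
  have h1 := h.deficit_le t
  have h2 := deficit_pos (A := A) (Y := Y) t ω
  have h3 := budget_le (pulls A 0 t ω)
  split_ifs <;> linarith

lemma norm_stepConst_le (h : IsTypical A Y ω) (t : ℕ) :
    ‖stepConst A Y t ω‖ ≤ 2 * 2 ^ t + 1 := by
  have h1 := h.deficit_le t
  have h2 := deficit_pos (A := A) (Y := Y) t ω
  rw [Real.norm_eq_abs, abs_le, stepConst]
  have h3 := budget_le (pulls A 0 t ω)
  have h4 := budget_nonneg (pulls A 0 t ω)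
  have h5 := budget_le (pulls A 0 t ω + 1)
  have h6 := budget_nonneg (pulls A 0 t ω + 1)
  split_ifs <;> constructor <;> linarith

lemma norm_stepSlope_le (h : IsTypical A Y ω) (t : ℕ) : ‖stepSlope A Y t ω‖ ≤ 2 ^ t + 1 := by
  have h1 := h.deficit_le t
  have h2 := deficit_pos (A := A) (Y := Y) t ω
  rw [Real.norm_eq_abs, abs_le, stepSlope]
  split_ifs <;> constructor <;> linarith

end IsTypical

end Bounds

/-! ### The expected potential -/

section Expectation

variable {Ω : Type*} {mΩ : MeasurableSpace Ω} {P : Measure Ω} {ℱ : Filtration ℕ mΩ}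
  {A : ℕ → Ω → Fin 2} {X : Fin 2 → ℕ → Ω → ℝ} {Y : ℕ → Ω → ℝ}

lemma IsBiasedRun.measurable_arm_of_le {E : BiasedBandit 2} (h : IsBiasedRun E P ℱ A X Y)
    {s t : ℕ} (hs : 1 ≤ s) (hst : s ≤ t + 1) : Measurable[ℱ t] (A s) := by
  obtain ⟨s, rfl⟩ := Nat.exists_eq_add_of_le' hs
  exact (h.measurable_arm s).mono (ℱ.mono (by omega)) le_rfl

lemma IsBiasedRun.measurable_feedback_of_le {E : BiasedBandit 2} (h : IsBiasedRun E P ℱ A X Y)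
    {s t : ℕ} (hs : 1 ≤ s) (hst : s ≤ t) : Measurable[ℱ t] (Y s) := by
  obtain ⟨s, rfl⟩ := Nat.exists_eq_add_of_le' hs
  exact (h.measurable_feedback s).mono (ℱ.mono hst) le_rfl

lemma IsUCBRun.ae_isTypical {E : BiasedBandit 2} (h : IsUCBRun E P ℱ A X Y) :
    ∀ᵐ ω ∂P, IsTypical A Y ω := by
  have h1 : ∀ᵐ ω ∂P, ∀ t, Y (t + 1) ω = 0 ∨ Y (t + 1) ω = 1 := ae_all_iff.2 h.bernoulli
  have h2 : ∀ᵐ ω ∂P, ∀ t, 2 < t → ∀ i, ucbIndex A Y i t ω ≤ ucbIndex A Y (A t ω) t ω := by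
    refine ae_all_iff.2 fun t => ?_
    by_cases ht : 2 < t
    · filter_upwards [h.ucb.argmax t ht] with ω hω _ using hω
    · exact .of_forall fun _ h => absurd h ht
  filter_upwards [h1, h2, h.ucb.initial 0, h.ucb.initial 1] with ω h1 h2 h3 h4
  exact ⟨h3, h4, h1, h2⟩

lemma IsUCBRun.integrable_potential {E : BiasedBandit 2} (h : IsUCBRun E P ℱ A X Y) (t : ℕ) :
    Integrable (potential A Y t) P := by
  have := h.run.isProbabilityMeasure
  refine Integrable.of_bound (C := 2 ^ t + 1) ?_ ?_
  · refine ((measurable_potential (m := ℱ t) ?_ ?_).mono (ℱ.le t) le_rfl).aestronglyMeasurable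
    · exact fun s h1 h2 => h.run.measurable_arm_of_le h1 (by omega)
    · exact fun s h1 h2 => h.run.measurable_feedback_of_le h1 h2
  · filter_upwards [h.ae_isTypical] with ω hω using hω.norm_potential_le t

/-- The expected potential does not increase. -/
lemma IsUCBRun.integral_potential_succ_le (h : IsUCBRun hardInstance P ℱ A X Y) (t : ℕ) :
    ∫ ω, potential A Y (t + 1) ω ∂P ≤ ∫ ω, potential A Y t ω ∂P := by
  have := h.run.isProbabilityMeasure
  have hA : ∀ s, 1 ≤ s → s ≤ t + 1 → Measurable[ℱ t] (A s) := fun s h1 h2 =>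
    h.run.measurable_arm_of_le h1 h2
  have hY : ∀ s, 1 ≤ s → s ≤ t → Measurable[ℱ t] (Y s) := fun s h1 h2 =>
    h.run.measurable_feedback_of_le h1 h2
  have hmU := measurable_stepConst hA hY
  have hmV := measurable_stepSlope hA hY
  have hU : Integrable (stepConst A Y t) P :=
    .of_bound (hmU.mono (ℱ.le t) le_rfl).aestronglyMeasurable (2 * 2 ^ t + 1) <| by
      filter_upwards [h.ae_isTypical] with ω hω using hω.norm_stepConst_le t
  have hVY : Integrable (stepSlope A Y t * Y (t + 1)) P :=
    (h.run.integrable_feedback t).bdd_mul (c := 2 ^ t + 1)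
      (hmV.mono (ℱ.le t) le_rfl).aestronglyMeasurable <| by
      filter_upwards [h.ae_isTypical] with ω hω using hω.norm_stepSlope_le t
  have hpull := condExp_mul_of_stronglyMeasurable_left hmV.stronglyMeasurable hVY
    (h.run.integrable_feedback t)
  calc ∫ ω, potential A Y (t + 1) ω ∂P
      ≤ ∫ ω, (stepConst A Y t ω + (stepSlope A Y t * Y (t + 1)) ω) ∂P := by
        refine integral_mono_ae (h.integrable_potential _) (hU.add hVY) ?_
        filter_upwards [h.ae_isTypical] with ω hω using hω.potential_succ_le t
    _ = ∫ ω, (stepConst A Y t ω + (P[stepSlope A Y t * Y (t + 1) | ℱ t]) ω) ∂P := by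
        rw [integral_add hU hVY, integral_add hU integrable_condExp, integral_condExp (ℱ.le t)]
    _ ≤ ∫ ω, potential A Y t ω ∂P := by
        refine integral_mono_ae (hU.add integrable_condExp) (h.integrable_potential _) ?_
        filter_upwards [h.ae_isTypical, hpull, h.run.condExp_feedback t] with ω hω h1 h2
        simp only [h1, Pi.mul_apply, h2, hardInstance_mean_mul_bias]
        exact hω.step_le_potential two_million_le_rpow t

lemma IsUCBRun.integral_potential_le (h : IsUCBRun hardInstance P ℱ A X Y) (t : ℕ) :
    ∫ ω, potential A Y t ω ∂P ≤ 1 / 100 := by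
  have := h.run.isProbabilityMeasure
  induction t with
  | zero => simp only [potential_zero, integral_const, probReal_univ, smul_eq_mul]; norm_num
  | succ t ih => exact (h.integral_potential_succ_le t).trans ih

lemma IsBiasedRun.integrable_pulls {E : BiasedBandit 2} (h : IsBiasedRun E P ℱ A X Y) (i : Fin 2)
    (n : ℕ) : Integrable (fun ω => (pulls A i n ω : ℝ)) P := by
  have := h.isProbabilityMeasure
  refine Integrable.of_bound (C := n) ?_ (.of_forall fun ω => ?_)
  · have h1 : Measurable (pulls A i n) := (measurable_pulls (m := ℱ n)
      (fun s h1 h2 => h.measurable_arm_of_le h1 (by omega)) i).mono (ℱ.le n) le_rfl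
    have h2 : Measurable fun ω => (pulls A i n ω : ℝ) := by fun_prop
    exact h2.aestronglyMeasurable
  · simpa using pulls_le A i n ω

lemma IsUCBRun.integral_pulls_zero_le (h : IsUCBRun hardInstance P ℱ A X Y) {n : ℕ}
    (hn : 16207 ≤ n) : ∫ ω, (pulls A 0 n ω : ℝ) ∂P ≤ n / 50 := by
  have := h.run.isProbabilityMeasure
  have hint := h.integrable_potential n
  calc ∫ ω, (pulls A 0 n ω : ℝ) ∂P ≤ ∫ ω, ((n : ℝ) / 100 + n * potential A Y n ω) ∂P := by
        refine integral_mono_ae (h.run.integrable_pulls 0 n)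
          ((integrable_const _).add (hint.const_mul _)) ?_
        filter_upwards [h.ae_isTypical] with ω hω using hω.pulls_zero_le_potential hn
    _ = n / 100 + n * ∫ ω, potential A Y n ω ∂P := by
        rw [integral_add (integrable_const _) (hint.const_mul _), integral_const_mul]; simp
    _ ≤ n / 100 + n * (1 / 100) := by gcongr; exact h.integral_potential_le n
    _ = n / 50 := by ring

/-! ### The regret -/

section Regret

variable {E : BiasedBandit 2}

lemma IsBiasedRun.integrable_reward (h : IsBiasedRun E P ℱ A X Y)
    (hE : E.IsAdmissible) (i : Fin 2) (t : ℕ) : Integrable (X i (t + 1)) P := by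
  have hl := h.hasLaw_reward i t
  have h1 := hE.integrable i
  rw [← hl.map_eq] at h1
  exact h1.comp_aemeasurable hl.aemeasurable

/-- The reward of a round is independent of the choice of the arm. -/
lemma IsBiasedRun.setIntegral_reward (h : IsBiasedRun E P ℱ A X Y) (i j : Fin 2)
    (t : ℕ) : ∫ ω in {ω | A (t + 1) ω = j}, X i (t + 1) ω ∂P =
      P.real {ω | A (t + 1) ω = j} * E.mean i := by
  have := h.isProbabilityMeasure
  have hl := h.hasLaw_reward i t
  have hs : MeasurableSet[ℱ t] {ω | A (t + 1) ω = j} :=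
    h.measurable_arm t (measurableSet_singleton j)
  have hmean : ∫ ω, X i (t + 1) ω ∂P = E.mean i := hl.integral_eq
  rw [← hmean]
  exact (h.indep_reward i t).symm.setIntegral_eq_mul (f := id) (ℱ.le t) hl.aemeasurable hs
    aestronglyMeasurable_id

/-- In every round the regret against arm `0` comes from the event that arm `1` is played. -/
lemma regret_round_eq_indicator (t : ℕ) :
    (fun ω => X 0 t ω - X (A t ω) t ω) =
      {ω | A t ω = 1}.indicator fun ω => X 0 t ω - X 1 t ω := by
  funext ω
  have hA : A t ω = 0 ∨ A t ω = 1 := by omega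
  rcases hA with hA | hA <;> simp [Set.indicator, hA]

lemma IsBiasedRun.measurableSet_arm_eq (h : IsBiasedRun E P ℱ A X Y) (i : Fin 2) (t : ℕ) :
    MeasurableSet {ω | A (t + 1) ω = i} :=
  ℱ.le t _ (h.measurable_arm t (measurableSet_singleton i))

lemma IsBiasedRun.integral_regret_round (h : IsBiasedRun E P ℱ A X Y)
    (hE : E.IsAdmissible) (t : ℕ) :
    ∫ ω, (X 0 (t + 1) ω - X (A (t + 1) ω) (t + 1) ω) ∂P =
      (E.mean 0 - E.mean 1) * P.real {ω | A (t + 1) ω = 1} := by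
  have hX := fun i => h.integrable_reward hE i t
  rw [regret_round_eq_indicator, integral_indicator (h.measurableSet_arm_eq 1 t),
    integral_sub (hX 0).integrableOn (hX 1).integrableOn,
    h.setIntegral_reward, h.setIntegral_reward]
  ring

lemma IsBiasedRun.integrable_regret_round (h : IsBiasedRun E P ℱ A X Y)
    (hE : E.IsAdmissible) (t : ℕ) :
    Integrable (fun ω => X 0 (t + 1) ω - X (A (t + 1) ω) (t + 1) ω) P := by
  rw [regret_round_eq_indicator]
  exact ((h.integrable_reward hE 0 t).sub (h.integrable_reward hE 1 t)).indicator
    (h.measurableSet_arm_eq 1 t)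

lemma IsBiasedRun.integral_pulls_eq_sum (h : IsBiasedRun E P ℱ A X Y) (i : Fin 2) (n : ℕ) :
    ∫ ω, (pulls A i n ω : ℝ) ∂P = ∑ t ∈ Finset.range n, P.real {ω | A (t + 1) ω = i} := by
  induction n with
  | zero => simp
  | succ n ih =>
    have := h.isProbabilityMeasure
    have hs := h.measurableSet_arm_eq i n
    have heq : (fun ω => (pulls A i (n + 1) ω : ℝ)) =
        fun ω => (pulls A i n ω : ℝ) + {ω | A (n + 1) ω = i}.indicator (fun _ => 1) ω := by
      funext ω
      rw [pulls_succ]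
      by_cases hA : A (n + 1) ω = i <;> simp [hA]
    rw [heq, integral_add (h.integrable_pulls i n) ((integrable_const 1).indicator hs), ih,
      integral_indicator_const _ hs, smul_eq_mul, mul_one, Finset.sum_range_succ]

/-- The regret against arm `0` is a lower bound for the regret. -/
lemma IsBiasedRun.mul_integral_pulls_le_regret (h : IsBiasedRun E P ℱ A X Y)
    (hE : E.IsAdmissible) (n : ℕ) :
    (E.mean 0 - E.mean 1) * ∫ ω, (pulls A 1 n ω : ℝ) ∂P ≤ regret P A X n := by
  refine le_trans (le_of_eq ?_) (le_ciSup (Set.finite_range _).bddAbove 0)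
  rw [h.integral_pulls_eq_sum, Finset.mul_sum]
  have hsum : ∀ g : ℕ → ℝ, ∑ t ∈ Finset.Icc 1 n, g t = ∑ t ∈ Finset.range n, g (t + 1) := by
    intro g
    rw [Finset.range_eq_Ico, Finset.sum_Ico_add' g 0 n 1]
    rfl
  simp only [hsum]
  rw [integral_finsetSum _ fun t _ => h.integrable_regret_round hE t]
  exact Finset.sum_congr rfl fun t _ => (h.integral_regret_round hE t).symm

lemma IsUCBRun.le_regret (h : IsUCBRun hardInstance P ℱ A X Y) {n : ℕ} (hn : 16207 ≤ n) :
    0.098 * (n : ℝ) ≤ regret P A X n := by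
  have := h.run.isProbabilityMeasure
  refine le_trans ?_ (h.run.mul_integral_pulls_le_regret hardInstance_isAdmissible n)
  have h0 := h.integral_pulls_zero_le hn
  have hsum : ∫ ω, (pulls A 0 n ω : ℝ) ∂P + ∫ ω, (pulls A 1 n ω : ℝ) ∂P = n := by
    rw [← integral_add (h.run.integrable_pulls 0 n) (h.run.integrable_pulls 1 n)]
    have : ∀ ω, (pulls A 0 n ω : ℝ) + pulls A 1 n ω = n := fun ω => by
      exact_mod_cast pulls_zero_add_pulls_one A n ω
    simp [this]
  rw [hardInstance_mean_zero, hardInstance_mean_one]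
  norm_num
  linarith

end Regret

end Expectation

/-! ### Conditional expectations given a countable history -/

/-- Freezing lemma: if `Z` is a countably valued variable of the past `m` and `V` is independent
of `m`, then conditionally on `m` a function of `Z` and `V` is averaged over `V` only. -/
lemma condExp_of_countable_history {Ω S R : Type*} {m mΩ : MeasurableSpace Ω} {P : Measure Ω}
    [IsProbabilityMeasure P] [MeasurableSpace R] [Countable S] (hm : m ≤ mΩ) {Z : Ω → S}
    {V : Ω → R} (hZ : ∀ z, MeasurableSet[m] (Z ⁻¹' {z})) (hV : Measurable V)
    (hind : Indep (MeasurableSpace.comap V inferInstance) m P) {g : S → R → ℝ}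
    (hg : ∀ z, Measurable (g z)) (hgV : ∀ z, Integrable (fun ω => g z (V ω)) P)
    (hint : Integrable (fun ω => g (Z ω) (V ω)) P) :
    P[fun ω => g (Z ω) (V ω) | m] =ᵐ[P] fun ω => ∫ ω', g (Z ω) (V ω') ∂P := by
  have key : ∀ z, (Z ⁻¹' {z}).indicator (P[fun ω => g (Z ω) (V ω) | m]) =ᵐ[P]
      (Z ⁻¹' {z}).indicator fun _ => ∫ ω', g z (V ω') ∂P := by
    intro z
    have heq : (Z ⁻¹' {z}).indicator (fun ω => g (Z ω) (V ω)) =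
        (Z ⁻¹' {z}).indicator fun ω => g z (V ω) := by
      refine Set.indicator_congr fun ω hω => ?_
      rw [show Z ω = z from hω]
    have hmeas : StronglyMeasurable[MeasurableSpace.comap V inferInstance] fun ω => g z (V ω) :=
      ((hg z).comp (comap_measurable V)).stronglyMeasurable
    have h1 := condExp_indicator hint (hZ z)
    have h2 := condExp_indicator (hgV z) (hZ z)
    have h3 := condExp_indep_eq hV.comap_le hm hmeas hind
    rw [heq] at h1
    filter_upwards [h1, h2, h3] with ω h1 h2 h3
    rw [← h1, h2]
    by_cases hω : ω ∈ Z ⁻¹' {z}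
    · rw [Set.indicator_of_mem hω, Set.indicator_of_mem hω, h3]
    · rw [Set.indicator_of_notMem hω, Set.indicator_of_notMem hω]
  filter_upwards [ae_all_iff.2 key] with ω hω
  simpa using hω (Z ω)

/-! ### A run of UCB -/

/-- What UCB remembers of each arm: the number of its pulls and the number of its successes. -/
abbrev History := Fin 2 → ℕ × ℕ

/-- The upper confidence index of an arm in round `t + 1`, computed from the history. -/
noncomputable def historyIndex (t : ℕ) (h : History) (i : Fin 2) : ℝ :=
  (h i).2 / (h i).1 + √(2 * Real.log ((t + 1 : ℕ) : ℝ) / (h i).1)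

open Classical in
/-- The arm that UCB plays in round `t + 1`. Ties are broken in favour of arm `0`. -/
noncomputable def ucbArm (t : ℕ) (h : History) : Fin 2 :=
  if t = 0 then 0 else if t = 1 then 1 else
    if historyIndex t h 1 ≤ historyIndex t h 0 then 0 else 1

/-- The success probability of round `t + 1`. -/
noncomputable def roundProb (t : ℕ) (h : History) : ℝ :=
  successProb ((16216 : ℝ) ^ (1.5 : ℝ)) (ucbArm t h) (h (ucbArm t h)).1 t

open Classical in
/-- The feedback of round `t + 1`, sampled by inversion from a uniform variable. -/
noncomputable def roundFeedback (t : ℕ) (h : History) (u : unitInterval) : ℕ :=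
  if (u : ℝ) ≤ roundProb t h then 1 else 0

/-- The sample points: each round draws a uniform variable for the feedback, and the true rewards
of both arms. -/
abbrev SamplePoint := ℕ → unitInterval × (Fin 2 → ℝ)

/-- The history after round `t + 1`, computed from the history before it. -/
noncomputable def updateHistory (t : ℕ) (h : History) (u : unitInterval) : History := fun i =>
  if ucbArm t h = i then ((h i).1 + 1, (h i).2 + roundFeedback t h u) else h i

/-- The history after `t` rounds. -/
noncomputable def history : ℕ → SamplePoint → History
  | 0, _ => fun _ => 0
  | t + 1, ω => updateHistory t (history t ω) (ω (t + 1)).1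

/-- The arm played in round `t ≥ 1`. -/
noncomputable def runArm (t : ℕ) (ω : SamplePoint) : Fin 2 := ucbArm (t - 1) (history (t - 1) ω)

/-- The feedback of round `t ≥ 1`. -/
noncomputable def runFeedback (t : ℕ) (ω : SamplePoint) : ℝ :=
  roundFeedback (t - 1) (history (t - 1) ω) (ω t).1

/-- The true reward of arm `i` in round `t`. -/
def runReward (i : Fin 2) (t : ℕ) (ω : SamplePoint) : ℝ := (ω t).2 i

instance (i : Fin 2) : IsProbabilityMeasure (hardInstance.ν i) :=
  hardInstance_isAdmissible.isProbabilityMeasure i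

/-- The rounds are independent, and so are the draws within a round. -/
noncomputable def sampleLaw : Measure SamplePoint :=
  Measure.infinitePi fun _ : ℕ => (volume : Measure unitInterval).prod (Measure.pi hardInstance.ν)

instance : IsProbabilityMeasure sampleLaw := by unfold sampleLaw; infer_instance

/-- The σ-algebra generated by the draws of the first rounds. -/
def runFiltration : Filtration ℕ (inferInstance : MeasurableSpace SamplePoint) := Filtration.piLE

lemma measurable_roundFeedback (t : ℕ) (h : History) : Measurable (roundFeedback t h) :=
  Measurable.ite (measurable_subtype_coe measurableSet_Iic) measurable_const measurable_const

lemma measurable_roundFeedback_fst (t : ℕ) (h : History) :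
    Measurable fun x : unitInterval × (Fin 2 → ℝ) => (roundFeedback t h x.1 : ℝ) := by
  have h1 := measurable_roundFeedback t h
  fun_prop

lemma measurable_sample {s t : ℕ} (hst : s ≤ t) :
    Measurable[runFiltration t] fun ω : SamplePoint => ω s := by
  have h : Measurable[runFiltration t] (Preorder.restrictLe (π := fun _ : ℕ =>
    unitInterval × (Fin 2 → ℝ)) t) := comap_measurable _
  exact (measurable_pi_apply (⟨s, hst⟩ : Iic t)).comp h

lemma indep_sample (t : ℕ) :
    Indep (MeasurableSpace.comap (fun ω : SamplePoint => ω (t + 1)) inferInstance)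
      (runFiltration t) sampleLaw := by
  have h := iIndepFun_infinitePi (P := fun _ : ℕ =>
    (volume : Measure unitInterval).prod (Measure.pi hardInstance.ν)) (X := fun _ x => x)
    (fun _ => measurable_id)
  have h2 := h.indepFun_finset {t + 1} (Finset.Iic t) (by simp) (fun i => measurable_pi_apply i)
  have h3 := h2.comp (measurable_pi_apply ⟨t + 1, by simp⟩) measurable_id
  have h4 : runFiltration t = MeasurableSpace.comap
      (fun (ω : SamplePoint) (i : Finset.Iic t) => ω i) inferInstance :=
    Filtration.piLE_eq_comap_frestrictLe t
  rw [h4]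
  exact h3

lemma measurable_history (t : ℕ) : Measurable[runFiltration t] (history t) := by
  induction t with
  | zero => exact measurable_const
  | succ t ih =>
    have h1 : Measurable[runFiltration (t + 1)] (history t) :=
      ih.mono (runFiltration.mono t.le_succ) le_rfl
    have h2 : Measurable[runFiltration (t + 1)] fun ω : SamplePoint => (ω (t + 1)).1 :=
      measurable_fst.comp (measurable_sample le_rfl)
    have hF : Measurable fun p : unitInterval × History => updateHistory t p.2 p.1 := by
      refine measurable_from_prod_countable_left fun h => measurable_pi_lambda _ fun i => ?_
      simp only [updateHistory]
      split_ifs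
      · exact measurable_const.prodMk (measurable_const.add (measurable_roundFeedback t h))
      · exact measurable_const
    have heq : history (t + 1) = (fun p : unitInterval × History => updateHistory t p.2 p.1) ∘
        fun ω => ((ω (t + 1)).1, history t ω) := by
      funext ω; rw [history]; rfl
    rw [heq]
    exact Measurable.comp hF (Measurable.prodMk h2 h1)

lemma history_fst (t : ℕ) (i : Fin 2) (ω : SamplePoint) :
    (history t ω i).1 = pulls runArm i t ω := by
  induction t with
  | zero => simp [history]
  | succ t ih =>
    rw [pulls_succ, ← ih, history, runArm, Nat.add_sub_cancel, updateHistory]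
    split_ifs <;> rfl

lemma history_snd (t : ℕ) (i : Fin 2) (ω : SamplePoint) :
    ((history t ω i).2 : ℝ) = feedbackSum runArm runFeedback i t ω := by
  induction t with
  | zero => simp [history]
  | succ t ih =>
    rw [feedbackSum_succ, ← ih, history, runArm, runFeedback, Nat.add_sub_cancel,
      updateHistory]
    split_ifs
    · push_cast; rfl
    · simp

lemma historyIndex_eq (t : ℕ) (i : Fin 2) (ω : SamplePoint) :
    historyIndex t (history t ω) i = ucbIndex runArm runFeedback i (t + 1) ω := by
  rw [historyIndex, ucbIndex, empMean_eq, Nat.add_sub_cancel, history_snd, history_fst]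

lemma roundProb_eq (t : ℕ) (ω : SamplePoint) :
    roundProb t (history t ω) = hardInstance.mean (runArm (t + 1) ω) *
      hardInstance.bias (runArm (t + 1) ω) (pulls runArm (runArm (t + 1) ω) t ω) t := by
  rw [hardInstance_mean_mul_bias, roundProb, history_fst]
  rfl

lemma roundProb_mem_Icc (t : ℕ) (ω : SamplePoint) :
    roundProb t (history t ω) ∈ Icc (0 : ℝ) 1 := by
  have hT := two_million_le_rpow
  have hle : ((history t ω (ucbArm t (history t ω))).1 : ℝ) ≤ t := by
    rw [history_fst]; exact_mod_cast pulls_le runArm _ t ω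
  set T := (16216 : ℝ) ^ (1.5 : ℝ) with hTdef
  have ht : (0 : ℝ) ≤ t := t.cast_nonneg
  rw [roundProb, successProb, ← hTdef]
  set k : ℝ := ((history t ω (ucbArm t (history t ω))).1 : ℝ)
  have hk : 0 ≤ k := Nat.cast_nonneg _
  have h1 : (10 + k) / (10 + T + t) ≤ 1 := (div_le_one (by linarith)).2 (by linarith)
  have h2 : (T + k) / (10 + T + t) ≤ 1 := (div_le_one (by linarith)).2 (by linarith)
  have h3 : 0 ≤ (10 + k) / (10 + T + t) := div_nonneg (by linarith) (by linarith)
  have h4 : 0 ≤ (T + k) / (10 + T + t) := div_nonneg (by linarith) (by linarith)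
  split_ifs <;> constructor <;> linarith

lemma roundFeedback_eq (t : ℕ) (h : History) (u : unitInterval) :
    roundFeedback t h u = 0 ∨ roundFeedback t h u = 1 := by
  unfold roundFeedback; split_ifs <;> simp

lemma roundFeedback_mem_Icc (t : ℕ) (h : History) (u : unitInterval) :
    (roundFeedback t h u : ℝ) ∈ Icc (0 : ℝ) 1 := by
  rcases roundFeedback_eq t h u with h | h <;> simp [h]

lemma map_sample (t : ℕ) : sampleLaw.map (fun ω => ω t) =
    (volume : Measure unitInterval).prod (Measure.pi hardInstance.ν) :=
  Measure.infinitePi_map_eval _ t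

/-- Inversion: the feedback has the prescribed success probability. -/
lemma integral_roundFeedback {t : ℕ} {h : History} (hp : roundProb t h ∈ Icc (0 : ℝ) 1) (s : ℕ) :
    ∫ ω, (roundFeedback t h (ω s).1 : ℝ) ∂sampleLaw = roundProb t h := by
  have h1 := measurable_roundFeedback t h
  have h2 : Measurable fun u => (roundFeedback t h u : ℝ) := by fun_prop
  rw [← integral_map (φ := fun ω : SamplePoint => ω s)
    (f := fun x => (roundFeedback t h x.1 : ℝ)) (measurable_pi_apply s).aemeasurable
    (measurable_roundFeedback_fst t h).aestronglyMeasurable, map_sample,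
    ← integral_map (φ := Prod.fst) (f := fun u => (roundFeedback t h u : ℝ)) (by fun_prop)
    h2.aestronglyMeasurable, Measure.map_fst_prod, measure_univ, one_smul]
  have h3 : (fun u => (roundFeedback t h u : ℝ)) =
      (Iic (⟨roundProb t h, hp⟩ : unitInterval)).indicator fun _ => 1 := by
    funext u
    have : (u : ℝ) ≤ roundProb t h ↔ u ∈ Iic (⟨roundProb t h, hp⟩ : unitInterval) := Iff.rfl
    by_cases hu : (u : ℝ) ≤ roundProb t h <;> simp [roundFeedback, Set.indicator, ← this, hu]
  rw [h3, integral_indicator_const _ measurableSet_Iic]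
  simp [Measure.real, unitInterval.volume_Iic, hp.1]

lemma measurable_runFeedback (t : ℕ) :
    Measurable[runFiltration (t + 1)] (runFeedback (t + 1)) := by
  have h1 : Measurable[runFiltration (t + 1)] (history t) :=
    (measurable_history t).mono (runFiltration.mono t.le_succ) le_rfl
  have hF : Measurable fun p : (unitInterval × (Fin 2 → ℝ)) × History =>
      (roundFeedback t p.2 p.1.1 : ℝ) :=
    measurable_from_prod_countable_left fun h => measurable_roundFeedback_fst t h
  exact hF.comp ((measurable_sample le_rfl).prodMk h1)

lemma integrable_runFeedback (t : ℕ) : Integrable (runFeedback (t + 1)) sampleLaw := by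
  refine Integrable.of_bound (C := 1)
    ((measurable_runFeedback t).mono (runFiltration.le _) le_rfl).aestronglyMeasurable
    (.of_forall fun ω => ?_)
  have h := roundFeedback_mem_Icc t (history t ω) (ω (t + 1)).1
  exact (Real.norm_of_nonneg h.1).trans_le h.2

lemma integrable_roundFeedback (t : ℕ) (h : History) (s : ℕ) :
    Integrable (fun ω : SamplePoint => (roundFeedback t h (ω s).1 : ℝ)) sampleLaw := by
  refine Integrable.of_bound (C := 1)
    ((measurable_roundFeedback_fst t h).comp (measurable_pi_apply s)).aestronglyMeasurable
    (.of_forall fun ω => ?_)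
  have h := roundFeedback_mem_Icc t h (ω s).1
  exact (Real.norm_of_nonneg h.1).trans_le h.2

lemma condExp_runFeedback (t : ℕ) : sampleLaw[runFeedback (t + 1) | runFiltration t]
    =ᵐ[sampleLaw] fun ω => roundProb t (history t ω) := by
  have h := condExp_of_countable_history (runFiltration.le t) (Z := history t)
    (V := fun ω : SamplePoint => ω (t + 1)) (P := sampleLaw)
    (fun z => measurable_history t (measurableSet_singleton z)) (by fun_prop) (indep_sample t)
    (g := fun h x => (roundFeedback t h x.1 : ℝ)) (measurable_roundFeedback_fst t)
    (fun h => integrable_roundFeedback t h (t + 1)) (integrable_runFeedback t)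
  refine h.trans (.of_forall fun ω => ?_)
  exact integral_roundFeedback (roundProb_mem_Icc t ω) (t + 1)

lemma subgaussian_runFeedback (t : ℕ) (l : ℝ) :
    Integrable (fun ω => Real.exp (l * (runFeedback (t + 1) ω -
      (sampleLaw[runFeedback (t + 1) | runFiltration t]) ω))) sampleLaw ∧
    sampleLaw[fun ω => Real.exp (l * (runFeedback (t + 1) ω -
      (sampleLaw[runFeedback (t + 1) | runFiltration t]) ω)) | runFiltration t]
      ≤ᵐ[sampleLaw] fun _ => Real.exp (l ^ 2 / 2) := by
  have hcongr : (fun ω => Real.exp (l * (runFeedback (t + 1) ω -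
      (sampleLaw[runFeedback (t + 1) | runFiltration t]) ω))) =ᵐ[sampleLaw]
      fun ω => Real.exp (l * (roundFeedback t (history t ω) (ω (t + 1)).1 -
        roundProb t (history t ω))) := by
    filter_upwards [condExp_runFeedback t] with ω hω
    rw [hω]; rfl
  have hint : Integrable (fun ω => Real.exp (l * (roundFeedback t (history t ω) (ω (t + 1)).1 -
      roundProb t (history t ω)))) sampleLaw := by
    have hm : Measurable fun ω => l * ((roundFeedback t (history t ω) (ω (t + 1)).1 : ℝ) -
        roundProb t (history t ω)) :=
      (((measurable_runFeedback t).mono (runFiltration.le _) le_rfl).sub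
        ((measurable_of_countable (roundProb t)).comp
          ((measurable_history t).mono (runFiltration.le t) le_rfl))).const_mul l
    refine Integrable.of_bound (C := Real.exp |l|) hm.exp.aestronglyMeasurable
      (.of_forall fun ω => ?_)
    rw [Real.norm_of_nonneg (Real.exp_pos _).le, Real.exp_le_exp]
    have h1 := roundFeedback_mem_Icc t (history t ω) (ω (t + 1)).1
    have h2 := roundProb_mem_Icc t ω
    refine (le_abs_self _).trans ?_
    rw [abs_mul]
    refine mul_le_of_le_one_right (abs_nonneg l) (abs_le.2 ⟨?_, ?_⟩) <;>
      linarith [h1.1, h1.2, h2.1, h2.2]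
  refine ⟨hint.congr hcongr.symm, ?_⟩
  have h := condExp_of_countable_history (runFiltration.le t) (Z := history t)
    (V := fun ω : SamplePoint => ω (t + 1)) (P := sampleLaw)
    (fun z => measurable_history t (measurableSet_singleton z)) (by fun_prop) (indep_sample t)
    (g := fun h x => Real.exp (l * ((roundFeedback t h x.1 : ℝ) - roundProb t h)))
    (fun h => (((measurable_roundFeedback_fst t h).sub_const _).const_mul l).exp)
    (fun h => integrable_exp_mul_of_mem_Icc (a := 0 - roundProb t h) (b := 1 - roundProb t h)
      (((measurable_roundFeedback_fst t h).sub_const _).comp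
        (measurable_pi_apply (t + 1))).aemeasurable
      (.of_forall fun ω => by
        have := roundFeedback_mem_Icc t h (ω (t + 1)).1
        exact ⟨sub_le_sub_right this.1 _, sub_le_sub_right this.2 _⟩)) hint
  filter_upwards [condExp_congr_ae hcongr, h] with ω h1 h2
  rw [h1, h2]
  -- Hoeffding's lemma for the feedback with the history frozen
  have hH := hasSubgaussianMGF_of_mem_Icc (μ := sampleLaw) (a := 0) (b := 1)
    (X := fun ω' => (roundFeedback t (history t ω) (ω' (t + 1)).1 : ℝ))
    ((measurable_roundFeedback_fst t (history t ω)).comp (measurable_pi_apply (t + 1))).aemeasurable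
    (.of_forall fun ω' => roundFeedback_mem_Icc ..)
  have h3 := hH.mgf_le l
  rw [integral_roundFeedback (roundProb_mem_Icc t ω)] at h3
  refine h3.trans (Real.exp_le_exp.2 ?_)
  norm_num
  nlinarith [sq_nonneg l]

lemma hasLaw_runReward (i : Fin 2) (t : ℕ) :
    HasLaw (runReward i t) (hardInstance.ν i) sampleLaw where
  aemeasurable := by 
    have h : Measurable (runReward i t) := by unfold runReward; fun_prop
    exact h.aemeasurable
  map_eq := by
    have h : runReward i t = Function.eval i ∘ Prod.snd ∘ fun ω : SamplePoint => ω t := rfl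
    rw [h, ← Measure.map_map (by fun_prop) (by fun_prop),
      ← Measure.map_map (by fun_prop) (by fun_prop), map_sample, Measure.map_snd_prod,
      measure_univ, one_smul]
    exact (measurePreserving_eval _ i).map_eq

lemma indep_runReward (i : Fin 2) (t : ℕ) :
    Indep (MeasurableSpace.comap (runReward i (t + 1)) inferInstance) (runFiltration t)
      sampleLaw := by
  refine indep_of_indep_of_le_left (indep_sample t) ?_
  have h : Measurable[MeasurableSpace.comap (fun ω : SamplePoint => ω (t + 1)) inferInstance]
      (runReward i (t + 1)) :=
    ((measurable_pi_apply i).comp measurable_snd).comp (comap_measurable _)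
  exact h.comap_le

lemma isUCB_run : IsUCB sampleLaw runArm runFeedback where
  initial i := .of_forall fun ω => by
    have hi : i = 0 ∨ i = 1 := by omega
    rcases hi with rfl | rfl <;> simp [runArm, ucbArm]
  argmax t ht := .of_forall fun ω i => by
    obtain ⟨t, rfl⟩ := Nat.exists_eq_add_of_le' (Nat.one_le_of_lt ht)
    rw [← historyIndex_eq, ← historyIndex_eq, runArm, Nat.add_sub_cancel, ucbArm,
      if_neg (by omega), if_neg (by omega)]
    have hi : i = 0 ∨ i = 1 := by omega
    split_ifs with h
    · rcases hi with rfl | rfl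
      exacts [le_rfl, h]
    · rcases hi with rfl | rfl
      exacts [(not_le.1 h).le, le_rfl]

lemma isUCBRun_run :
    IsUCBRun hardInstance sampleLaw runFiltration runArm runReward runFeedback where
  run :=
    { isProbabilityMeasure := inferInstance
      measurable_arm := fun t => (measurable_of_countable (ucbArm t)).comp (measurable_history t)
      measurable_feedback := measurable_runFeedback
      integrable_feedback := integrable_runFeedback
      hasLaw_reward := fun i t => hasLaw_runReward i (t + 1)
      indep_reward := indep_runReward
      condExp_feedback := fun t => (condExp_runFeedback t).trans
        (.of_forall fun ω => roundProb_eq t ω)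
      subgaussian_feedback := subgaussian_runFeedback }
  bernoulli t := .of_forall fun ω => by
    rcases roundFeedback_eq t (history t ω) (ω (t + 1)).1 with h | h <;>
      simp [runFeedback, h]
  ucb := isUCB_run

end AffinityBandit

theorem mainTheorem3 :
    ∃ E : AffinityBandit.BiasedBandit 2,
      E.IsAdmissible ∧ E.IsBernoulli ∧
      E.mean 0 = 0.9 ∧ E.mean 1 = 0.8 ∧
      E.T0 0 = 10 ∧ E.T0 1 = (16216 : ℝ) ^ (1.5 : ℝ) ∧
      (∀ i x, E.f i x = x) ∧
      (∃ (Ω : Type) (_ : MeasurableSpace Ω) (P : Measure Ω) (ℱ : Filtration ℕ ‹_›)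
        (A : ℕ → Ω → Fin 2) (X : Fin 2 → ℕ → Ω → ℝ) (Y : ℕ → Ω → ℝ),
        AffinityBandit.IsUCBRun E P ℱ A X Y) ∧
      ∀ (Ω : Type*) (_ : MeasurableSpace Ω) (P : Measure Ω) (ℱ : Filtration ℕ ‹_›)
        (A : ℕ → Ω → Fin 2) (X : Fin 2 → ℕ → Ω → ℝ) (Y : ℕ → Ω → ℝ),
        AffinityBandit.IsUCBRun E P ℱ A X Y →
        ∀ n : ℕ, 16207 ≤ n → 0.098 * (n : ℝ) ≤ AffinityBandit.regret P A X n := by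
  open AffinityBandit in
  exact ⟨hardInstance, hardInstance_isAdmissible, hardInstance_isBernoulli,
    by rw [hardInstance_mean_zero]; norm_num, by rw [hardInstance_mean_one]; norm_num,
    rfl, rfl, fun _ _ => rfl,
    ⟨SamplePoint, inferInstance, sampleLaw, runFiltration, runArm, runReward, runFeedback,
      isUCBRun_run⟩,
    fun _ _ _ _ _ _ _ h _ hn => h.le_regret hn⟩
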